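/- Let $\sigma(z)=\max\{z,0\}$ be the ReLU activation function and let $d\ge 2$. For a Borel probability measure $\pi$ on $\mathbb R\times\mathbb R^d\times\mathbb R$ with $\int |a|\,(|w|+|b|)\,d\pi(a,w,b)<\infty$ put $$f_\pi(x)=\int a\,\sigma(w^Tx+b)\,d\pi(a,w,b),\qquad x\in\mathbb R^d .$$ A function $f$ is called a Barron function on a set $U\subseteq\mathbb R^d$ if $f=f_\pi$ on $U$ for some such $\pi$, equivalently, if its Barron norm on $U$, $$\|f\|_{\mathcal B(U)}=\inf\Big\{\int |a|\,(|w|+|b|)\,d\pi \;:\; \pi \text{ a Borel probability measure with } f=f_\pi \text{ on } U\Big\},$$ is finite. Lemma. The function $g(x)=\sigma(x_1)=\max\{x_1,0\}$ is a Barron function on $\mathbb R^d$. Let $B^d$ be the open unit ball in $\mathbb R^d$ and let $u\in C^2(B^d)\cap C(\overline{B^d})$ be the solution of $$-\Delta u=0\ \text{ in } B^d,\qquad u=g\ \text{ on } \partial B^d .$$ If $d\ge 3$, then $u$ is not a Barron function on $B^d$. -/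

import Mathlib

open MeasureTheory
open scoped ENNReal

noncomputable section

/-- The ReLU activation function. -/
def relu (z : ℝ) : ℝ := max z 0

/-- The parameters `(a, w, b)` of a single neuron on `ℝ^d`. -/
abbrev NeuronParam (d : ℕ) : Type := ℝ × EuclideanSpace ℝ (Fin d) × ℝ

/-- The infinitely wide two-layer ReLU network
`f_π(x) = ∫ a σ(wᵀ x + b) π(da ⊗ dw ⊗ db)`. -/
def barronRealization {d : ℕ} (π : Measure (NeuronParam d)) (x : EuclideanSpace ℝ (Fin d)) : ℝ :=
  ∫ p, p.1 * relu (inner ℝ p.2.1 x + p.2.2) ∂π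

/-- The cost `∫ |a| (|w| + |b|) π(da ⊗ dw ⊗ db)` of a parameter distribution,
with values in `[0, ∞]`. If it is finite, the integral defining `barronRealization π x`
converges absolutely for every `x`. -/
def barronCost {d : ℕ} (π : Measure (NeuronParam d)) : ℝ≥0∞ :=
  ∫⁻ p, ENNReal.ofReal (|p.1| * (‖p.2.1‖ + |p.2.2|)) ∂π

/-- The ReLU-Barron norm of `f` on `U ⊆ ℝ^d`: the infimum of the costs of all Borel probability
measures `π` on the parameter space with `f = f_π` on `U` (it is `∞` if there is no such `π`
of finite cost). -/
def barronNormOn {d : ℕ} (U : Set (EuclideanSpace ℝ (Fin d)))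
    (f : EuclideanSpace ℝ (Fin d) → ℝ) : ℝ≥0∞ :=
  ⨅ (π : Measure (NeuronParam d)) (_ : IsProbabilityMeasure π)
    (_ : ∀ x ∈ U, f x = barronRealization π x), barronCost π

/-- `f` is a (ReLU-)Barron function on `U`: its Barron norm on `U` is finite. -/
def IsBarronOn {d : ℕ} (U : Set (EuclideanSpace ℝ (Fin d)))
    (f : EuclideanSpace ℝ (Fin d) → ℝ) : Prop :=
  barronNormOn U f < ⊤

/-- `u` is a classical solution of the Dirichlet problem `-Δ u = 0` in `U`, `u = g` on `∂U`:
it is `C²` and harmonic in `U`, continuous on the closure of `U`, and equal to `g` on `∂U`. -/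
structure IsDirichletSolution {d : ℕ} (U : Set (EuclideanSpace ℝ (Fin d)))
    (g u : EuclideanSpace ℝ (Fin d) → ℝ) : Prop where
  harmonicContOnCl : InnerProductSpace.HarmonicContOnCl u U
  boundary : ∀ x ∈ frontier U, u x = g x

end

open Filter Topology

/-! ### Barron functions -/

/-! The function `g` is a single neuron. The negative part is a regularity obstruction: a
finite-cost network is globally Lipschitz, so a Barron `u` that is continuous up to the sphere is
Lipschitz on the closed ball. But the kink of `g` makes `u` grow like `t log (1/t)` at distance `t`
from a sphere point `e_j` with `j ≠ i`, where `i` is the kink coordinate. This growth comes from a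
barrier `v = -y log ρ + K (r - y) - ρ`. Its Laplacian is `K / r - d y / ρ² - (d - 1) / ρ`, positive
for `K = 2 d` since `y, r ≤ ρ`. On the sphere `v ≤ K |x i|`, and `|x i|` has harmonic extension `2 u
- x i`; so `v ≤ K (2 u - x i)` in the ball by the maximum principle
(`nonpos_of_forall_hasSecondDeriv`). On the radius to `e_j` this reads `t (-log t - 1) ≤ 2 K u`,
while `u e_j = 0`: no Lipschitz constant survives `t → 0`. -/

lemma measurable_barron_integrand {d : ℕ} (x : EuclideanSpace ℝ (Fin d)) :
    Measurable (fun p : NeuronParam d => p.1 * relu (inner ℝ p.2.1 x + p.2.2)) := by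
  unfold relu
  fun_prop

lemma abs_relu_sub_le (s t : ℝ) : |relu s - relu t| ≤ |s - t| :=
  abs_max_sub_max_le_abs s t 0

lemma abs_relu_le (s : ℝ) : |relu s| ≤ |s| := by
  simpa [relu] using abs_relu_sub_le s 0

lemma integrable_barron_weight {d : ℕ} {π : Measure (NeuronParam d)} (hπ : barronCost π < ⊤) :
    Integrable (fun p : NeuronParam d => |p.1| * (‖p.2.1‖ + |p.2.2|)) π := by
  refine ⟨by fun_prop, ?_⟩
  rw [hasFiniteIntegral_iff_ofReal (ae_of_all _ fun p => by positivity)]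
  exact hπ

lemma integrable_barron_integrand {d : ℕ} {π : Measure (NeuronParam d)} (hπ : barronCost π < ⊤)
    (x : EuclideanSpace ℝ (Fin d)) :
    Integrable (fun p : NeuronParam d => p.1 * relu (inner ℝ p.2.1 x + p.2.2)) π := by
  refine ((integrable_barron_weight hπ).const_mul (1 + ‖x‖)).mono'
    (measurable_barron_integrand x).aestronglyMeasurable (ae_of_all _ fun p => ?_)
  rw [norm_mul, Real.norm_eq_abs, Real.norm_eq_abs]
  have h1 : |relu (inner ℝ p.2.1 x + p.2.2)| ≤ ‖p.2.1‖ * ‖x‖ + |p.2.2| :=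
    (abs_relu_le _).trans ((abs_add_le _ _).trans
      (add_le_add (abs_real_inner_le_norm _ _) le_rfl))
  have h2 : ‖p.2.1‖ * ‖x‖ + |p.2.2| ≤ (1 + ‖x‖) * (‖p.2.1‖ + |p.2.2|) := by
    nlinarith [norm_nonneg x, norm_nonneg p.2.1, abs_nonneg p.2.2,
      mul_nonneg (norm_nonneg x) (abs_nonneg p.2.2)]
  calc |p.1| * |relu (inner ℝ p.2.1 x + p.2.2)|
      ≤ |p.1| * ((1 + ‖x‖) * (‖p.2.1‖ + |p.2.2|)) := by gcongr; exact h1.trans h2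
    _ = _ := by ring

/-- A network of finite cost is Lipschitz continuous. -/
lemma abs_barronRealization_sub_le {d : ℕ} {π : Measure (NeuronParam d)}
    (hπ : barronCost π < ⊤) (x y : EuclideanSpace ℝ (Fin d)) :
    |barronRealization π x - barronRealization π y| ≤
      (∫ p, |p.1| * (‖p.2.1‖ + |p.2.2|) ∂π) * ‖x - y‖ := by
  unfold barronRealization
  rw [← integral_sub (integrable_barron_integrand hπ x) (integrable_barron_integrand hπ y),
    ← integral_mul_const, ← Real.norm_eq_abs]
  refine norm_integral_le_of_norm_le
    ((integrable_barron_weight hπ).mul_const _) (ae_of_all _ fun p => ?_)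
  rw [← mul_sub, norm_mul, Real.norm_eq_abs, Real.norm_eq_abs, mul_assoc]
  gcongr
  have h := abs_relu_sub_le (inner ℝ p.2.1 x + p.2.2) (inner ℝ p.2.1 y + p.2.2)
  rw [add_sub_add_right_eq_sub, ← inner_sub_right] at h
  refine h.trans ((abs_real_inner_le_norm _ _).trans ?_)
  gcongr
  linarith [abs_nonneg p.2.2]

lemma IsBarronOn.exists_measure {d : ℕ} {U : Set (EuclideanSpace ℝ (Fin d))}
    {f : EuclideanSpace ℝ (Fin d) → ℝ} (hf : IsBarronOn U f) :
    ∃ π : Measure (NeuronParam d), (∀ x ∈ U, f x = barronRealization π x) ∧ barronCost π < ⊤ := by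
  unfold IsBarronOn barronNormOn at hf
  simp only [iInf_lt_iff] at hf
  obtain ⟨π, -, h, hc⟩ := hf
  exact ⟨π, h, hc⟩

/-- A Barron function on `U` that is continuous on the closure of `U` is Lipschitz there. -/
lemma IsBarronOn.exists_lipschitz_closure {d : ℕ} {U : Set (EuclideanSpace ℝ (Fin d))}
    {f : EuclideanSpace ℝ (Fin d) → ℝ} (hf : IsBarronOn U f) (hc : ContinuousOn f (closure U)) :
    ∃ L : ℝ, ∀ x ∈ closure U, ∀ y ∈ closure U, |f x - f y| ≤ L * ‖x - y‖ := by
  obtain ⟨π, hπ, hcost⟩ := hf.exists_measure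
  set L := ∫ p, |p.1| * (‖p.2.1‖ + |p.2.2|) ∂π
  have hL0 : 0 ≤ L := integral_nonneg fun p => by positivity
  have hcont : Continuous (barronRealization π) :=
    (LipschitzWith.of_dist_le_mul (K := ⟨L, hL0⟩) fun x y => by
      rw [Real.dist_eq, dist_eq_norm]
      exact abs_barronRealization_sub_le hcost x y).continuous
  have heq : Set.EqOn f (barronRealization π) (closure U) :=
    Set.EqOn.of_subset_closure hπ hc hcont.continuousOn subset_closure subset_rfl
  refine ⟨L, fun x hx y hy => ?_⟩
  rw [heq hx, heq hy]
  exact abs_barronRealization_sub_le hcost x y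

lemma isBarronOn_relu_coord {d : ℕ} (i : Fin d) (U : Set (EuclideanSpace ℝ (Fin d))) :
    IsBarronOn U (fun x => relu (x i)) := by
  unfold IsBarronOn barronNormOn
  simp only [iInf_lt_iff]
  -- One neuron with `a = 1`, `w = e_i`, `b = 0`.
  refine ⟨Measure.dirac (1, EuclideanSpace.single i 1, 0), inferInstance, fun x _ => ?_, ?_⟩
  · rw [barronRealization, integral_dirac]
    simp [EuclideanSpace.inner_single_left]
  · rw [barronCost, lintegral_dirac]
    exact ENNReal.ofReal_lt_top

/-! ### Second derivatives at the origin of the line -/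

/-- `f` is differentiable near `0` and its derivative has derivative `c` at `0`. -/
def HasSecondDeriv (f : ℝ → ℝ) (c : ℝ) : Prop :=
  ∃ f' : ℝ → ℝ, (∀ᶠ t in 𝓝 0, HasDerivAt f (f' t) t) ∧ HasDerivAt f' c 0

lemma HasSecondDeriv.add {f g : ℝ → ℝ} {a b : ℝ} (hf : HasSecondDeriv f a)
    (hg : HasSecondDeriv g b) : HasSecondDeriv (fun t => f t + g t) (a + b) := by
  obtain ⟨f', hf', hfa⟩ := hf
  obtain ⟨g', hg', hgb⟩ := hg
  refine ⟨fun t => f' t + g' t, ?_, hfa.add hgb⟩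
  filter_upwards [hf', hg'] with t h1 h2 using h1.add h2

lemma HasSecondDeriv.const_mul {f : ℝ → ℝ} {a : ℝ} (hf : HasSecondDeriv f a) (k : ℝ) :
    HasSecondDeriv (fun t => k * f t) (k * a) := by
  obtain ⟨f', hf', hfa⟩ := hf
  refine ⟨fun t => k * f' t, ?_, hfa.const_mul k⟩
  filter_upwards [hf'] with t h1 using h1.const_mul k

lemma hasSecondDeriv_affine (a c : ℝ) : HasSecondDeriv (fun t => a + c * t) 0 := by
  refine ⟨fun _ => c, Eventually.of_forall fun t => ?_, hasDerivAt_const _ _⟩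
  simpa using ((hasDerivAt_id t).const_mul c).const_add a

/-- If `c > 0`, the second derivative test makes `0` a local minimum as well, so `f` is locally
constant and `c = 0`. -/
lemma HasSecondDeriv.nonpos_of_isLocalMax {f : ℝ → ℝ} {c : ℝ} (hf : HasSecondDeriv f c)
    (hmax : IsLocalMax f 0) : c ≤ 0 := by
  obtain ⟨f', hf', hc⟩ := hf
  by_contra! hpos
  have hd : deriv f =ᶠ[𝓝 0] f' := by
    filter_upwards [hf'] with t ht using ht.deriv
  have hdd : deriv (deriv f) 0 = c := by rw [hd.deriv_eq, hc.deriv]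
  have hmin : IsLocalMin f 0 := isLocalMin_of_deriv_deriv_pos (by rw [hdd]; exact hpos)
    hmax.deriv_eq_zero hf'.self_of_nhds.continuousAt
  have hconst : f =ᶠ[𝓝 0] fun _ => f 0 := by
    filter_upwards [hmax, hmin] with t h1 h2 using le_antisymm h1 h2
  have h0 : deriv f =ᶠ[𝓝 0] fun _ => 0 := by
    filter_upwards [hconst.deriv] with t ht
    rw [ht, deriv_const]
  rw [h0.deriv_eq, deriv_const] at hdd
  exact hpos.ne hdd

lemma hasDerivAt_quadratic (q m n t : ℝ) :
    HasDerivAt (fun t => q + 2 * m * t + n * t ^ 2) (2 * m + 2 * n * t) t := by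
  have h := (((hasDerivAt_id t).const_mul (2 * m)).const_add q).add
    (((hasDerivAt_id t).pow 2).const_mul n)
  refine h.congr_deriv ?_
  norm_num
  ring

lemma eventually_quadratic_pos {q : ℝ} (hq : 0 < q) (m n : ℝ) :
    ∀ᶠ t in 𝓝 (0 : ℝ), 0 < q + 2 * m * t + n * t ^ 2 := by
  have hc : Continuous fun t : ℝ => q + 2 * m * t + n * t ^ 2 := by fun_prop
  exact hc.continuousAt.eventually (lt_mem_nhds (by simpa using hq))

/-- Along a coordinate line `ρ²` and `r²` are quadratic in the parameter, so this lemma and the next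
differentiate every nonlinear term of the barrier. -/
lemma hasSecondDeriv_sqrt_quadratic {q : ℝ} (hq : 0 < q) (m n : ℝ) :
    HasSecondDeriv (fun t => √(q + 2 * m * t + n * t ^ 2)) (n / √q - m ^ 2 / (q * √q)) := by
  refine ⟨fun t => (2 * m + 2 * n * t) / (2 * √(q + 2 * m * t + n * t ^ 2)), ?_, ?_⟩
  · filter_upwards [eventually_quadratic_pos hq m n] with t ht
    exact (hasDerivAt_quadratic q m n t).sqrt ht.ne'
  · have h1 : HasDerivAt (fun t : ℝ => 2 * m + 2 * n * t) (2 * n) 0 := by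
      simpa using ((hasDerivAt_id (0 : ℝ)).const_mul (2 * n)).const_add (2 * m)
    have h2 := ((hasDerivAt_quadratic q m n 0).sqrt (by simpa using hq.ne')).const_mul 2
    have hs : 0 < √q := Real.sqrt_pos.2 hq
    have h3 := h1.div h2 (by simpa using hs.ne')
    refine h3.congr_deriv ?_
    norm_num
    have hsq : √q ^ 2 = q := Real.sq_sqrt hq.le
    field_simp
    rw [hsq]
    ring

lemma hasSecondDeriv_affine_mul_log_quadratic {q : ℝ} (hq : 0 < q) (m n y c : ℝ) :
    HasSecondDeriv (fun t => (y + c * t) * Real.log (q + 2 * m * t + n * t ^ 2))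
      (4 * c * m / q + y * (2 * n / q - 4 * m ^ 2 / q ^ 2)) := by
  have ha : ∀ t, HasDerivAt (fun t : ℝ => y + c * t) c t := fun t => by
    simpa using ((hasDerivAt_id t).const_mul c).const_add y
  refine ⟨fun t => c * Real.log (q + 2 * m * t + n * t ^ 2) +
    (y + c * t) * ((2 * m + 2 * n * t) / (q + 2 * m * t + n * t ^ 2)), ?_, ?_⟩
  · filter_upwards [eventually_quadratic_pos hq m n] with t ht
    exact (ha t).mul ((hasDerivAt_quadratic q m n t).log ht.ne')
  · have h1 : HasDerivAt (fun t : ℝ => 2 * m + 2 * n * t) (2 * n) 0 := by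
      simpa using ((hasDerivAt_id (0 : ℝ)).const_mul (2 * n)).const_add (2 * m)
    have h2 := hasDerivAt_quadratic q m n 0
    have h3 := ((h2.log (by simpa using hq.ne')).const_mul c).add
      ((ha 0).mul (h1.div h2 (by simpa using hq.ne')))
    refine h3.congr_deriv ?_
    norm_num
    field_simp
    ring

/-! ### The maximum principle -/

/-- Lets the harmonic `u` enter the maximum principle: over an orthonormal basis these second
derivatives sum to the Laplacian. -/
lemma hasSecondDeriv_line {E : Type*} [NormedAddCommGroup E] [NormedSpace ℝ E] {u : E → ℝ}
    {x : E} (hu : ContDiffAt ℝ 2 u x) (v : E) :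
    HasSecondDeriv (fun t : ℝ => u (x + t • v)) (iteratedFDeriv ℝ 2 u x ![v, v]) := by
  have hline : ∀ t : ℝ, HasDerivAt (fun t : ℝ => x + t • v) v t := fun t => by
    simpa using ((hasDerivAt_id t).smul_const v).const_add x
  have ht : Tendsto (fun t : ℝ => x + t • v) (𝓝 0) (𝓝 x) := by
    simpa using (hline 0).continuousAt.tendsto
  refine ⟨fun t => fderiv ℝ u (x + t • v) v, ?_, ?_⟩
  · have hev : ∀ᶠ z in 𝓝 x, DifferentiableAt ℝ u z := by
      filter_upwards [hu.eventually (by simp)] with z hz using hz.differentiableAt (by simp)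
    filter_upwards [ht.eventually hev] with t hdt
    exact hdt.hasFDerivAt.comp_hasDerivAt t (hline t)
  · have hd : DifferentiableAt ℝ (fderiv ℝ u) x :=
      (hu.fderiv_right (m := 1) (by norm_num)).differentiableAt (by simp)
    have hd' : HasFDerivAt (fderiv ℝ u) (fderiv ℝ (fderiv ℝ u) x) (x + (0 : ℝ) • v) := by
      simpa using hd.hasFDerivAt
    have h : HasDerivAt (fun t : ℝ => fderiv ℝ u (x + t • v)) (fderiv ℝ (fderiv ℝ u) x v) 0 :=
      hd'.comp_hasDerivAt (0 : ℝ) (hline 0)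
    have h2 := (ContinuousLinearMap.apply ℝ ℝ v).hasFDerivAt.comp_hasDerivAt (0 : ℝ) h
    rw [iteratedFDeriv_two_apply]
    exact h2

/-- Weak maximum principle for functions with positive sum of the pure second derivatives. -/
lemma nonpos_of_forall_hasSecondDeriv {d : ℕ} {U : Set (EuclideanSpace ℝ (Fin d))}
    (hU : IsOpen U) (hb : Bornology.IsBounded U) {φ : EuclideanSpace ℝ (Fin d) → ℝ}
    (hφ : ContinuousOn φ (closure U)) (hfr : ∀ x ∈ frontier U, φ x ≤ 0)
    (hpos : ∀ x ∈ U, ∃ c : Fin d → ℝ, 0 < ∑ i, c i ∧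
      ∀ i, HasSecondDeriv (fun t => φ (x + t • EuclideanSpace.single i (1 : ℝ))) (c i)) :
    ∀ x ∈ closure U, φ x ≤ 0 := by
  intro x hx
  have hcomp : IsCompact (closure U) := hb.isCompact_closure
  obtain ⟨z, hz, hmax⟩ := hcomp.exists_isMaxOn ⟨x, hx⟩ hφ
  refine (hmax hx).trans ?_
  by_cases hzU : z ∈ U
  · exfalso
    obtain ⟨c, hc, hder⟩ := hpos z hzU
    refine hc.not_ge (Finset.sum_nonpos fun i _ => (hder i).nonpos_of_isLocalMax ?_)
    have hcont : Continuous fun t : ℝ => z + t • EuclideanSpace.single i (1 : ℝ) := by fun_prop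
    have hmem : ∀ᶠ t in 𝓝 (0 : ℝ), z + t • EuclideanSpace.single i (1 : ℝ) ∈ U :=
      hcont.continuousAt.eventually (hU.mem_nhds (by simpa using hzU))
    filter_upwards [hmem] with t ht
    simpa using hmax (subset_closure ht)
  · exact hfr z ⟨hz, fun h => hzU (interior_subset h)⟩

lemma InnerProductSpace.HarmonicAt.sum_iteratedFDeriv_eq_zero {d : ℕ}
    {u : EuclideanSpace ℝ (Fin d) → ℝ} {x : EuclideanSpace ℝ (Fin d)}
    (hu : InnerProductSpace.HarmonicAt u x) :
    ∑ i, iteratedFDeriv ℝ 2 u x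
      ![EuclideanSpace.single i (1 : ℝ), EuclideanSpace.single i (1 : ℝ)] = 0 := by
  have h := hu.2.self_of_nhds
  rw [InnerProductSpace.laplacian_eq_iteratedFDeriv_orthonormalBasis u
    (EuclideanSpace.basisFun (Fin d) ℝ)] at h
  simpa using h

/-! ### A subharmonic barrier with a logarithmic slope at a boundary point -/

/-- With `y = 1 - x j`, `ρ = ‖x - e_j‖` and `r = √((x i)² + y²)`, this is the function
`-y log ρ + K (r - y) - ρ`. -/
noncomputable def logBarrier {d : ℕ} (i j : Fin d) (K : ℝ) (x : EuclideanSpace ℝ (Fin d)) : ℝ :=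
  -(1 / 2) * ((1 - x j) * Real.log (‖x - EuclideanSpace.single j (1 : ℝ)‖ ^ 2)) +
    K * √(x i ^ 2 + (1 - x j) ^ 2) + -K * (1 - x j) + -1 * ‖x - EuclideanSpace.single j (1 : ℝ)‖

section

variable {d : ℕ} {i j : Fin d} {K : ℝ} {x : EuclideanSpace ℝ (Fin d)}

lemma abs_one_sub_coord_le (j : Fin d) (x : EuclideanSpace ℝ (Fin d)) :
    |1 - x j| ≤ ‖x - EuclideanSpace.single j (1 : ℝ)‖ := by
  have h := PiLp.norm_apply_le (x - EuclideanSpace.single j (1 : ℝ)) j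
  rw [abs_sub_comm]
  simpa using h

lemma one_sub_coord_pos (hx : x ∈ Metric.ball (0 : EuclideanSpace ℝ (Fin d)) 1) (j : Fin d) :
    0 < 1 - x j := by
  have h := PiLp.norm_apply_le x j
  rw [mem_ball_zero_iff] at hx
  rw [Real.norm_eq_abs] at h
  linarith [le_abs_self (x j)]

/-- At `e_j`, `|y| ≤ ρ` reduces the claim to `ρ log ρ → 0`. -/
lemma continuous_coord_mul_log (j : Fin d) :
    Continuous fun x : EuclideanSpace ℝ (Fin d) =>
      (1 - x j) * Real.log (‖x - EuclideanSpace.single j (1 : ℝ)‖ ^ 2) := by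
  rw [continuous_iff_continuousAt]
  intro z
  by_cases hz : z = EuclideanSpace.single j 1
  · subst hz
    have hc : Continuous fun x : EuclideanSpace ℝ (Fin d) =>
        2 * |‖x - EuclideanSpace.single j (1 : ℝ)‖ *
          Real.log ‖x - EuclideanSpace.single j (1 : ℝ)‖| :=
      ((Real.continuous_mul_log.comp (by fun_prop :
        Continuous fun x : EuclideanSpace ℝ (Fin d) =>
          ‖x - EuclideanSpace.single j (1 : ℝ)‖)).abs).const_mul 2
    have ht := hc.tendsto (EuclideanSpace.single j (1 : ℝ))
    simp only [sub_self, norm_zero, zero_mul, abs_zero, mul_zero] at ht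
    unfold ContinuousAt
    simp only [sub_self, norm_zero, PiLp.single_apply, if_true, zero_mul]
    refine squeeze_zero_norm (fun x => ?_) ht
    rw [Real.log_pow, norm_mul, Real.norm_eq_abs, Real.norm_eq_abs, abs_mul, abs_mul, abs_norm]
    have h := mul_le_mul_of_nonneg_right (abs_one_sub_coord_le j x)
      (abs_nonneg (Real.log ‖x - EuclideanSpace.single j (1 : ℝ)‖))
    norm_num
    linarith
  · refine ContinuousAt.mul (by fun_prop) (ContinuousAt.log (by fun_prop) ?_)
    exact pow_ne_zero 2 (norm_ne_zero_iff.2 (sub_ne_zero.2 hz))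

lemma continuous_logBarrier (i j : Fin d) (K : ℝ) : Continuous (logBarrier i j K) := by
  have := continuous_coord_mul_log j
  unfold logBarrier
  fun_prop

/-- On the sphere `y = ρ² / 2`, so `-y log ρ ≤ ρ` is absorbed by the term `-ρ`, and `r - y ≤ |x i|`.
-/
lemma logBarrier_le_of_norm_eq_one (hK : 0 ≤ K) (hx : ‖x‖ = 1) :
    logBarrier i j K x ≤ K * |x i| := by
  set ρ := ‖x - EuclideanSpace.single j (1 : ℝ)‖ with hρ
  have hy : 1 - x j = ρ ^ 2 / 2 := by
    rw [hρ, norm_sub_sq_real, hx, EuclideanSpace.inner_single_right]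
    simp
    ring
  have hy0 : 0 ≤ 1 - x j := by rw [hy]; positivity
  have hr : √(x i ^ 2 + (1 - x j) ^ 2) ≤ |x i| + (1 - x j) := by
    refine Real.sqrt_le_iff.2 ⟨by positivity, ?_⟩
    rw [← sq_abs (x i)]
    nlinarith [mul_nonneg (abs_nonneg (x i)) hy0]
  have hlog : -(1 / 2) * ((1 - x j) * Real.log (ρ ^ 2)) ≤ ρ := by
    have hρ0 : 0 ≤ ρ := norm_nonneg _
    -- At `ρ = 0` the convention `log 0 = 0` applies; otherwise `-log ρ ≤ 1 / ρ - 1`.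
    rcases hρ0.eq_or_lt with h0 | h0
    · rw [← h0]; simp
    · have h1 := Real.log_le_sub_one_of_pos (inv_pos.2 h0)
      rw [Real.log_inv] at h1
      have h2 : ρ ^ 2 * -Real.log ρ ≤ ρ ^ 2 * (ρ⁻¹ - 1) :=
        mul_le_mul_of_nonneg_left h1 (sq_nonneg ρ)
      have h3 : ρ ^ 2 * (ρ⁻¹ - 1) = ρ - ρ ^ 2 := by field_simp
      rw [hy, Real.log_pow]
      push_cast
      nlinarith
  have hKr := mul_le_mul_of_nonneg_left hr hK
  unfold logBarrier
  rw [← hρ]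
  linarith

/-- On this radius `y = ρ = r = t`, so the `K` terms cancel. -/
lemma logBarrier_smul_single (hij : i ≠ j) {t : ℝ} (ht : 0 ≤ t) :
    logBarrier i j K ((1 - t) • EuclideanSpace.single j (1 : ℝ)) = t * (-Real.log t - 1) := by
  have h : (1 - t) • EuclideanSpace.single j (1 : ℝ) - EuclideanSpace.single j (1 : ℝ) =
      (-t) • EuclideanSpace.single j (1 : ℝ) := by
    rw [sub_smul, one_smul, neg_smul]
    abel
  unfold logBarrier
  rw [h, norm_smul]
  simp [hij, Real.sqrt_sq ht, abs_of_nonneg ht]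
  ring

/-- The pure second derivatives of `logBarrier`. -/
noncomputable def logBarrierSecondDeriv (i j : Fin d) (K : ℝ) (x : EuclideanSpace ℝ (Fin d))
    (k : Fin d) : ℝ :=
  2 / ‖x - EuclideanSpace.single j (1 : ℝ)‖ ^ 2 *
      ((if k = j then 1 else 0) * (x - EuclideanSpace.single j (1 : ℝ)) k) +
    (-(1 - x j) / ‖x - EuclideanSpace.single j (1 : ℝ)‖ ^ 2 -
      1 / ‖x - EuclideanSpace.single j (1 : ℝ)‖) +
    (2 * (1 - x j) / ‖x - EuclideanSpace.single j (1 : ℝ)‖ ^ 4 +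
      1 / ‖x - EuclideanSpace.single j (1 : ℝ)‖ ^ 3) *
        (x - EuclideanSpace.single j (1 : ℝ)) k ^ 2 +
    K / √(x i ^ 2 + (1 - x j) ^ 2) * ((if k = i then 1 else 0) + (if k = j then 1 else 0)) -
    K / √(x i ^ 2 + (1 - x j) ^ 2) ^ 3 *
      ((if k = i then x i else 0) - (if k = j then 1 - x j else 0)) ^ 2

lemma hasSecondDeriv_logBarrier (hij : i ≠ j) (hx : 0 < 1 - x j) (k : Fin d) :
    HasSecondDeriv (fun t => logBarrier i j K (x + t • EuclideanSpace.single k (1 : ℝ)))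
      (logBarrierSecondDeriv i j K x k) := by
  set e := EuclideanSpace.single j (1 : ℝ) with he
  set ρ := ‖x - e‖ with hρ
  set R := x i ^ 2 + (1 - x j) ^ 2 with hR
  set m := (if k = i then x i else 0) - (if k = j then 1 - x j else 0) with hm
  set n : ℝ := (if k = i then 1 else 0) + (if k = j then 1 else 0) with hn
  set δ : ℝ := if k = j then 1 else 0 with hδ
  have hρ0 : 0 < ρ := hx.trans_le ((le_abs_self _).trans (abs_one_sub_coord_le j x))
  have hR0 : 0 < R := by positivity
  have hQt : ∀ t : ℝ, ‖x + t • EuclideanSpace.single k (1 : ℝ) - e‖ ^ 2 =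
      ρ ^ 2 + 2 * (x - e) k * t + 1 * t ^ 2 := fun t => by
    rw [add_sub_right_comm, norm_add_sq_real, inner_smul_right, norm_smul,
      EuclideanSpace.inner_single_right]
    simp
    ring
  have hyt : ∀ t : ℝ, 1 - (x + t • EuclideanSpace.single k (1 : ℝ)) j =
      (1 - x j) + -δ * t := fun t => by
    by_cases hkj : k = j
    · simp [hδ, hkj]; ring
    · simp [hδ, hkj, Ne.symm hkj]
  have hRt : ∀ t : ℝ, (x + t • EuclideanSpace.single k (1 : ℝ)) i ^ 2 +
      (1 - (x + t • EuclideanSpace.single k (1 : ℝ)) j) ^ 2 = R + 2 * m * t + n * t ^ 2 :=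
    fun t => by
    rw [hyt, hm, hn, hR, hδ]
    by_cases hki : k = i
    · subst hki; simp [hij]; ring
    · by_cases hkj : k = j
      · subst hkj; simp [hki, Ne.symm hki]; ring
      · simp [hki, hkj, Ne.symm hki]
  have h := (((hasSecondDeriv_affine_mul_log_quadratic (pow_pos hρ0 2) ((x - e) k) 1
    (1 - x j) (-δ)).const_mul (-(1 / 2))).add
      ((hasSecondDeriv_sqrt_quadratic hR0 m n).const_mul K)).add
        ((hasSecondDeriv_affine (1 - x j) (-δ)).const_mul (-K)) |>.add
          ((hasSecondDeriv_sqrt_quadratic (pow_pos hρ0 2) ((x - e) k) 1).const_mul (-1))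
  have hfun : (fun t => logBarrier i j K (x + t • EuclideanSpace.single k (1 : ℝ))) = fun t =>
      -(1 / 2) * (((1 - x j) + -δ * t) * Real.log (ρ ^ 2 + 2 * (x - e) k * t + 1 * t ^ 2)) +
      K * √(R + 2 * m * t + n * t ^ 2) + -K * ((1 - x j) + -δ * t) +
      -1 * √(ρ ^ 2 + 2 * (x - e) k * t + 1 * t ^ 2) := by
    funext t
    rw [← hQt, ← hRt, ← hyt, Real.sqrt_sq (norm_nonneg _)]
    rfl
  rw [hfun]
  convert h using 1
  have hsR : √R ^ 2 = R := Real.sq_sqrt hR0.le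
  have hsR0 : 0 < √R := Real.sqrt_pos.2 hR0
  have hRR : R * √R = √R ^ 3 := by rw [pow_succ, hsR]
  rw [logBarrierSecondDeriv, Real.sqrt_sq hρ0.le, hRR, ← he, ← hρ, ← hR, ← hm, ← hn, ← hδ]
  field_simp
  ring

lemma sum_logBarrierSecondDeriv_pos (hij : i ≠ j) (hx : 0 < 1 - x j) :
    0 < ∑ k, logBarrierSecondDeriv i j (2 * d) x k := by
  set e := EuclideanSpace.single j (1 : ℝ) with he
  set ρ := ‖x - e‖ with hρ
  set r := √(x i ^ 2 + (1 - x j) ^ 2) with hr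
  have hyρ : 1 - x j ≤ ρ := (le_abs_self _).trans (abs_one_sub_coord_le j x)
  have hρ0 : 0 < ρ := hx.trans_le hyρ
  have hr2 : r ^ 2 = x i ^ 2 + (1 - x j) ^ 2 := Real.sq_sqrt (by positivity)
  have hr0 : 0 < r := Real.sqrt_pos.2 (by positivity)
  have hsum : ∑ k, (x - e) k ^ 2 = ρ ^ 2 := by
    rw [hρ, EuclideanSpace.real_norm_sq_eq]
  have hrρ : r ≤ ρ := by
    refine (sq_le_sq₀ hr0.le hρ0.le).1 ?_
    -- `r²` is the part of `ρ²` carried by the coordinates `i` and `j`.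
    have h := Finset.sum_le_sum_of_subset_of_nonneg (Finset.subset_univ {i, j})
      (f := fun k => (x - e) k ^ 2) fun k _ _ => sq_nonneg _
    rw [Finset.sum_pair hij, hsum] at h
    have hi : (x - e) i = x i := by simp [he, hij]
    have hj : (x - e) j = x j - 1 := by simp [he]
    rw [hi, hj] at h
    rw [hr2]
    linarith
  have hm : ∑ k, ((if k = i then x i else 0) - (if k = j then 1 - x j else 0)) ^ 2 = r ^ 2 := by
    have : ∀ k, ((if k = i then x i else 0) - (if k = j then 1 - x j else 0)) ^ 2 =
        (if k = i then x i ^ 2 else 0) + (if k = j then (1 - x j) ^ 2 else 0) := fun k => by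
      by_cases hki : k = i
      · subst hki; simp [hij]
      · simp [hki]
    rw [hr2]
    simp [this, Finset.sum_add_distrib]
  have hb : ∑ k, ((if k = j then (1 : ℝ) else 0) * (x - e) k) = -(1 - x j) := by
    simp [he]
  have htotal : ∑ k, logBarrierSecondDeriv i j (2 * d) x k =
      2 * d / r - d * (1 - x j) / ρ ^ 2 - (d - 1) / ρ := by
    simp only [logBarrierSecondDeriv, Finset.sum_add_distrib, Finset.sum_sub_distrib,
      ← Finset.mul_sum, ← he, ← hρ, ← hr]
    rw [hb, hsum, hm]
    simp only [Finset.sum_ite_eq', Finset.mem_univ, if_true, Finset.sum_const, Finset.card_univ, Fintype.card_fin, nsmul_eq_mul]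
    field_simp
    ring
  have h1 : 2 * d / ρ ≤ 2 * d / r := by gcongr
  have h2 : d * (1 - x j) / ρ ^ 2 ≤ d / ρ := by
    rw [div_le_div_iff₀ (by positivity) hρ0]
    have : (1 - x j) * ρ ≤ ρ ^ 2 := by nlinarith
    have hd : (0 : ℝ) ≤ d := by positivity
    nlinarith
  have h3 : 2 * d / ρ - d / ρ - (d - 1) / ρ = 1 / ρ := by ring
  have h4 : 0 < 1 / ρ := by positivity
  rw [htotal]
  linarith

end

/-- The harmonic extension of `relu (x i)` from the unit sphere to the unit ball is not Lipschitz
at the boundary points of the hyperplane `x i = 0`. -/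
lemma not_lipschitz_of_isDirichletSolution_relu {d : ℕ} {i j : Fin d} (hij : i ≠ j)
    {u : EuclideanSpace ℝ (Fin d) → ℝ}
    (hu : IsDirichletSolution (Metric.ball 0 1) (fun x => relu (x i)) u) (L : ℝ) :
    ¬ ∀ x ∈ closure (Metric.ball 0 1), ∀ y ∈ closure (Metric.ball 0 1),
      |u x - u y| ≤ L * ‖x - y‖ := by
  intro hL
  set K : ℝ := 2 * d with hK
  have hK0 : 0 ≤ K := by positivity
  have hle : ∀ x ∈ closure (Metric.ball (0 : EuclideanSpace ℝ (Fin d)) 1),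
      logBarrier i j K x + (-(2 * K) * u x + K * x i) ≤ 0 := by
    -- The added term is harmonic and equals `-K |x i|` on the sphere, because `|s| = 2 relu s - s`.
    refine nonpos_of_forall_hasSecondDeriv Metric.isOpen_ball Metric.isBounded_ball ?_ ?_ ?_
    · have := (continuous_logBarrier i j K).continuousOn
        (s := closure (Metric.ball (0 : EuclideanSpace ℝ (Fin d)) 1))
      have := hu.harmonicContOnCl.continuousOn
      fun_prop
    · intro x hx
      have h1 := hu.boundary x hx
      have hn : ‖x‖ = 1 := by
        rw [frontier_ball _ one_ne_zero] at hx
        simpa using hx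
      have h2 := logBarrier_le_of_norm_eq_one (i := i) (j := j) hK0 hn
      have h3 : |x i| = 2 * relu (x i) - x i := by
        unfold relu
        rcases le_total 0 (x i) with h | h
        · rw [abs_of_nonneg h, max_eq_left h]; ring
        · rw [abs_of_nonpos h, max_eq_right h]; ring
      rw [h3] at h2
      rw [h1]
      linarith
    · intro x hx
      have hy := one_sub_coord_pos hx j
      have hh := hu.harmonicContOnCl.harmonicOnNhd x hx
      refine ⟨fun k => logBarrierSecondDeriv i j K x k + (-(2 * K) * iteratedFDeriv ℝ 2 u x
        ![EuclideanSpace.single k (1 : ℝ), EuclideanSpace.single k (1 : ℝ)] + K * 0), ?_,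
        fun k => ?_⟩
      · rw [Finset.sum_add_distrib, Finset.sum_add_distrib, ← Finset.mul_sum,
          hh.sum_iteratedFDeriv_eq_zero]
        simpa using sum_logBarrierSecondDeriv_pos hij hy
      · have haff := (hasSecondDeriv_affine (x i) (if i = k then 1 else 0)).const_mul K
        have h := (hasSecondDeriv_logBarrier (K := K) hij hy k).add
          (((hasSecondDeriv_line hh.1 (EuclideanSpace.single k (1 : ℝ))).const_mul
            (-(2 * K))).add haff)
        convert h using 4 with t
        simp [PiLp.single_apply]
  set M := 2 * K * |L| with hM
  have hM0 : 0 ≤ M := by positivity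
  -- Chosen so that `-log t - 1 = M + 1`, which exceeds the slope `M` allowed by the Lipschitz
  -- bound.
  set t := Real.exp (-(M + 2)) with ht
  have ht0 : 0 < t := Real.exp_pos _
  have ht1 : t < 1 := Real.exp_lt_one_iff.2 (by linarith)
  have hcl : closure (Metric.ball (0 : EuclideanSpace ℝ (Fin d)) 1) = Metric.closedBall 0 1 :=
    closure_ball _ one_ne_zero
  have he : EuclideanSpace.single j (1 : ℝ) ∈
      closure (Metric.ball (0 : EuclideanSpace ℝ (Fin d)) 1) := by
    rw [hcl]; simp
  have hte : (1 - t) • EuclideanSpace.single j (1 : ℝ) ∈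
      closure (Metric.ball (0 : EuclideanSpace ℝ (Fin d)) 1) := by
    rw [hcl, mem_closedBall_zero_iff, norm_smul, Real.norm_eq_abs, abs_of_pos (by linarith)]
    simp
    exact ht0.le
  have hue : u (EuclideanSpace.single j (1 : ℝ)) = 0 := by
    rw [hu.boundary _ (by rw [frontier_ball _ one_ne_zero]; simp)]
    simp [relu, hij]
  have h1 := hle _ hte
  have h2 := hL _ hte _ he
  have h3 : ‖(1 - t) • EuclideanSpace.single j (1 : ℝ) - EuclideanSpace.single j (1 : ℝ)‖ = t := by
    rw [sub_smul, one_smul, sub_sub_cancel_left, norm_neg, norm_smul]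
    simp [abs_of_pos ht0]
  rw [logBarrier_smul_single hij ht0.le, ht, Real.log_exp, ← ht] at h1
  rw [hue, h3, sub_zero] at h2
  have h4 : L * t ≤ |L| * t := by gcongr; exact le_abs_self L
  have h5 : 2 * K * u ((1 - t) • EuclideanSpace.single j (1 : ℝ)) ≤ M * t := by
    rw [hM, mul_assoc _ |L|]
    exact mul_le_mul_of_nonneg_left ((le_abs_self _).trans (h2.trans h4)) (by positivity)
  have h6 : ((1 - t) • EuclideanSpace.single j (1 : ℝ)) i = 0 := by simp [hij]
  rw [h6] at h1
  nlinarith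

theorem mainTheorem4 (d : ℕ) (hd : 2 ≤ d) (g : EuclideanSpace ℝ (Fin d) → ℝ)
    (hg : ∀ x, g x = relu (x ⟨0, by omega⟩)) :
    IsBarronOn Set.univ g ∧
      (3 ≤ d → ∀ u : EuclideanSpace ℝ (Fin d) → ℝ,
        IsDirichletSolution (Metric.ball 0 1) g u → ¬ IsBarronOn (Metric.ball 0 1) u) := by
  obtain rfl : g = fun x => relu (x ⟨0, by omega⟩) := funext hg
  refine ⟨isBarronOn_relu_coord _ _, fun _ u hu hB => ?_⟩
  obtain ⟨L, hL⟩ := hB.exists_lipschitz_closure hu.harmonicContOnCl.continuousOn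
  exact not_lipschitz_of_isDirichletSolution_relu (j := ⟨1, by omega⟩) (by simp) hu L hL
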